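/- A \emph{circulant} is an $n\times n$ matrix $(a_{i,j})$ for which $a_{i,j}$ depends only on $i-j$ modulo $n$; a \emph{0-1 circulant} is a circulant with all entries in $\{0,1\}$, and its \emph{weight} is the number of $1$'s in each row. For an $n\times n$ 0-1 circulant $A$, label the columns from left to right by $0,1,\dots,n-1$ and let $S_A\subseteq\mathbb{Z}/n\mathbb{Z}$ be the set of residue classes of the labels of the columns in which the top row of $A$ contains a $1$. \textbf{Theorem.} Let $k\in\{4,5\}$, let $n$ be a positive integer all of whose prime factors are greater than $2k(k-1)$, and let $A$ and $B$ be $n\times n$ 0-1 circulants of weight $k$. Then the following are equivalent: \begin{enumerate} \item[(1)] There exist $u,v\in\mathbb{Z}/n\mathbb{Z}$ such that $\gcd(u,n)=1$ and $S_A=uS_B+v$. \item[(2)] There are $n\times n$ permutation matrices $P,Q$ such that $A=PBQ$. \item[(3)] There is an $n\times n$ permutation matrix $P$ such that $AA^T=PBB^TP^{-1}$. \item[(4)] The complex matrices $AA^T$ and $BB^T$ are similar. \end{enumerate} -/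

import Mathlib

/-- `A` is a 0-1 circulant: every entry is `0` or `1`, and the entry in row `i`, column `j`
depends only on `i - j` modulo `n`. Rows and columns of an `n × n` matrix are labelled
`0, 1, …, n - 1`, read as residues modulo `n`; the top row is row `0`. -/
structure IsZeroOneCirculant {n : ℕ} (A : Matrix (ZMod n) (ZMod n) ℂ) : Prop where
  zero_or_one : ∀ i j, A i j = 0 ∨ A i j = 1
  circulant : ∃ v : ZMod n → ℂ, A = Matrix.circulant v

/-- `A` has weight `k`: each row contains exactly `k` entries equal to `1`. -/
def HasWeight {n : ℕ} (A : Matrix (ZMod n) (ZMod n) ℂ) (k : ℕ) : Prop :=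
  ∀ i, {j : ZMod n | A i j = 1}.ncard = k

/-- The set `S_A` of columns in which the top row of `A` contains an entry `1`. -/
def residueSet {n : ℕ} (A : Matrix (ZMod n) (ZMod n) ℂ) : Set (ZMod n) :=
  {j | A 0 j = 1}

/-- Affine equivalence of residue sets: `S = u T + v` for some unit `u` and some `v`. -/
def AffinelyEquivalent {n : ℕ} (S T : Set (ZMod n)) : Prop :=
  ∃ u v : ZMod n, IsUnit u ∧ S = (fun t => u * t + v) '' T

/-- `P` is a permutation matrix. -/
def IsPermutationMatrix {n : ℕ} (P : Matrix (ZMod n) (ZMod n) ℂ) : Prop :=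
  ∃ σ : Equiv.Perm (ZMod n), P = σ.permMatrix ℂ

/-- Similarity of complex matrices. -/
def AreSimilar {n : ℕ} [NeZero n] (M N : Matrix (ZMod n) (ZMod n) ℂ) : Prop :=
  ∃ P : Matrix (ZMod n) (ZMod n) ℂ, IsUnit P ∧ M = P * N * P⁻¹

/-! Only the passage from similarity to affine equivalence is deep. The characters diagonalise `A *
A.transpose`, with eigenvalues `∑ ζ^(c(s_i - s_j))` over pairs of points of the residue set.
Similarity makes the eigenvalue of `A` at `c = 1` an eigenvalue of `B` at some multiplier `j`. The
diagonal terms cancel, leaving an integer relation among `n`-th roots of unity of total weight at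
most `2k(k-1)`, below every prime factor of `n`. Such a relation is trivial
(`eq_zero_of_charSum_one_eq_zero`), so the differences of `s` are those of `j t` as multisets. The
symmetric argument and an idempotent trick make `j` a unit.

It remains to recover at most five points from their differences, up to translation and reflection.
Over a field this is Newton's identities: the even difference moments determine the polynomial of
the centred points up to `X ↦ -X`. Modulo composite `n` there is no field, so the coincidences of
differences are lifted from `ZMod n` to `ℤ`, one prime at a time, and the field case is applied over
`ℚ`. Each lift works because the linear system has short rows: by Hadamard its minors are smaller
than `p`. -/

/-! ### Short vanishing sums of roots of unity -/

/-- The Fourier coefficient at `a` of an integer-valued function on `ℤ/n`. -/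
noncomputable def charSum {n : ℕ} [NeZero n] (f : ZMod n → ℤ) (a : ZMod n) : ℂ :=
  ∑ d, (ZMod.stdAddChar (d * a) : ℂ) * (f d : ℂ)

theorem charSum_injective {n : ℕ} [NeZero n] {f : ZMod n → ℤ} (h : ∀ a, charSum f a = 0) :
    f = 0 := by
  have key : ZMod.dft (fun d => (f d : ℂ)) = 0 := by
    ext a
    rw [ZMod.dft_apply]
    have := h (-a)
    unfold charSum at this
    simpa [smul_eq_mul] using this
  have h0 : (fun d => (f d : ℂ)) = 0 := by
    simpa using (LinearEquiv.map_eq_zero_iff _).1 key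
  ext d
  have := congrFun h0 d
  simpa using this

theorem isPrimitiveRoot_stdAddChar_one (n : ℕ) [NeZero n] :
    IsPrimitiveRoot (ZMod.stdAddChar (1 : ZMod n) : ℂ) n := by
  have := ZMod.stdAddChar_coe (N := n) 1
  simp only [Int.cast_one] at this
  rw [this]
  simpa using Complex.isPrimitiveRoot_exp n (NeZero.ne n)

theorem stdAddChar_eq_pow {n : ℕ} [NeZero n] (d : ZMod n) (m : ℕ) :
    (ZMod.stdAddChar (d * (m : ZMod n)) : ℂ) = (ZMod.stdAddChar (1 : ZMod n) ^ m) ^ d.val := by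
  rw [← AddChar.map_nsmul_eq_pow, ← AddChar.map_nsmul_eq_pow]
  congr 1
  simp

open Polynomial in
/-- Vanishing of a Fourier coefficient at `1` propagates to all units by Galois conjugation. -/
theorem charSum_eq_zero_of_isUnit {n : ℕ} [NeZero n] {f : ZMod n → ℤ} (h : charSum f 1 = 0)
    {a : ZMod n} (ha : IsUnit a) : charSum f a = 0 := by
  set ζ : ℂ := ZMod.stdAddChar (1 : ZMod n) with hζ
  have hprim : IsPrimitiveRoot ζ n := isPrimitiveRoot_stdAddChar_one n
  let P : ℤ[X] := ∑ d : ZMod n, C (f d) * X ^ d.val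
  have eval (m : ℕ) : aeval (ζ ^ m) P = charSum f (m : ZMod n) := by
    simp only [P, charSum, map_sum, map_mul, map_pow, aeval_X]
    refine Finset.sum_congr rfl fun d _ => ?_
    rw [stdAddChar_eq_pow, mul_comm]
    simp [hζ]
  have hP : aeval ζ P = 0 := by
    have := eval 1
    simpa [h] using this
  have hint : IsIntegral ℤ ζ := hprim.isIntegral (NeZero.pos n)
  have hcop : Nat.Coprime a.val n := by
    have := ZMod.val_coe_unit_coprime ha.unit
    simpa using this
  have hdvd : minpoly ℤ (ζ ^ a.val) ∣ P := by
    rw [← hprim.minpoly_eq_pow_coprime hcop]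
    exact minpoly.isIntegrallyClosed_dvd hint hP
  have h0 : aeval (ζ ^ a.val) P = 0 := by
    obtain ⟨Q, hQ⟩ := hdvd
    rw [hQ, map_mul, minpoly.aeval, zero_mul]
  rw [eval] at h0
  simpa using h0

/-- The iterated difference operator `∏ p, (1 - translation by n / p)`. -/
def iterDiff {n : ℕ} : List ℕ → (ZMod n → ℤ) → ZMod n → ℤ
  | [], f => f
  | p :: l, f => fun x => iterDiff l f x - iterDiff l f (x + ((n / p : ℕ) : ZMod n))

theorem charSum_diff {n : ℕ} [NeZero n] (f : ZMod n → ℤ) (h a : ZMod n) :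
    charSum (fun x => f x - f (x + h)) a = (1 - ZMod.stdAddChar (-h * a)) * charSum f a := by
  unfold charSum
  simp only [Int.cast_sub, mul_sub, Finset.sum_sub_distrib, sub_mul, one_mul]
  congr 1
  rw [← Equiv.sum_comp (Equiv.addRight h) (fun d => (ZMod.stdAddChar (d * a) : ℂ) * (f d : ℂ)),
    Finset.mul_sum]
  refine Finset.sum_congr rfl fun d _ => ?_
  rw [← mul_assoc, ← AddChar.map_add_eq_mul]
  simp only [Equiv.coe_addRight]
  congr 2
  ring_nf

/-- Each difference by `n / p` multiplies the coefficient at `a` by `1 - ζ^(-(n/p)a)`, which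
vanishes when `(n/p)a = 0`. This disposes of the frequencies that Galois conjugation does not reach.
-/
theorem charSum_iterDiff_eq_zero {n : ℕ} [NeZero n] {f : ZMod n → ℤ} {a : ZMod n} (l : List ℕ)
    (h : charSum f a = 0 ∨ ∃ p ∈ l, ((n / p : ℕ) : ZMod n) * a = 0) :
    charSum (iterDiff l f) a = 0 := by
  induction l with
  | nil => simpa [iterDiff] using h
  | cons q l ih =>
    simp only [iterDiff]
    rw [charSum_diff]
    rcases h with h | ⟨p, hp, hpa⟩
    · rw [ih (Or.inl h), mul_zero]
    · rcases List.mem_cons.1 hp with rfl | hp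
      · rw [neg_mul, hpa]; simp
      · rw [ih (Or.inr ⟨p, hp, hpa⟩), mul_zero]

/-- All steps `n / p` preserve `X`, so the operator never mixes values inside and outside it. -/
theorem iterDiff_indicator {n : ℕ} (f : ZMod n → ℤ) (X : ZMod n → Prop) [DecidablePred X]
    (l : List ℕ) (hX : ∀ p ∈ l, ∀ x, X (x + ((n / p : ℕ) : ZMod n)) ↔ X x) (x : ZMod n) :
    iterDiff l (fun y => if X y then f y else 0) x = if X x then iterDiff l f x else 0 := by
  induction l generalizing x with
  | nil => rfl
  | cons q l ih =>
    have ih' := ih fun p hp => hX p (List.mem_cons_of_mem _ hp)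
    simp only [iterDiff]
    rw [ih', ih']
    simp only [hX q List.mem_cons_self]
    split_ifs <;> simp

theorem natCast_mul_div_eq_zero_iff {n p m : ℕ} [NeZero n] (hp : p ∣ n) :
    ((m * (n / p) : ℕ) : ZMod n) = 0 ↔ p ∣ m := by
  rw [ZMod.natCast_eq_zero_iff]
  obtain ⟨c, rfl⟩ := hp
  have hpc : p * c ≠ 0 := NeZero.ne _
  have hp0 : 0 < p := Nat.pos_of_ne_zero fun h => by simp [h] at hpc
  have hc : 0 < c := Nat.pos_of_ne_zero fun h => by simp [h] at hpc
  rw [Nat.mul_div_cancel_left _ hp0]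
  exact Nat.mul_dvd_mul_iff_right hc

-- Peeling off the operator for `q` leaves a function `F` of period `n / q`. The support of `f` has
-- fewer than `q` points, so one of `q` disjoint cosets misses it; `F` vanishes there, hence by
-- periodicity on the coset of any chosen point. Induction applies to `f` restricted to that coset.
open Classical in
theorem eq_zero_of_iterDiff_eq_zero {n : ℕ} [NeZero n] (l : List ℕ) (hnodup : l.Nodup)
    (hl : ∀ p ∈ l, p.Prime ∧ p ∣ n) (f : ZMod n → ℤ) (hf : ∀ p ∈ l, ∑ x, |f x| < p)
    (h : iterDiff l f = 0) : f = 0 := by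
  induction l generalizing f with
  | nil => exact h
  | cons q l ih =>
    obtain ⟨hql, hnd⟩ := List.nodup_cons.1 hnodup
    obtain ⟨hqp, hqn⟩ := hl q List.mem_cons_self
    set g : ZMod n := ((n / q : ℕ) : ZMod n) with hg
    set F := iterDiff l f with hF
    have hper : ∀ x, F (x + g) = F x := fun x => by
      have := congrFun h x
      simp only [iterDiff, Pi.zero_apply] at this
      exact (sub_eq_zero.1 this).symm
    have hper' : ∀ (i : ℕ) x, F (x + i * g) = F x := by
      intro i
      induction i with
      | zero => simp
      | succ i ihi => intro x; rw [← ihi x, ← hper (x + i * g)]; congr 1; push_cast; ring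
    let m : ℕ := l.prod
    by_contra hne
    obtain ⟨x, hx⟩ : ∃ x, f x ≠ 0 := by
      by_contra hcon
      push Not at hcon
      exact hne (funext hcon)
    -- `X i` is the coset of `x + i * g` modulo the kernel of multiplication by `m`. That kernel
    -- contains every `n / p` with `p ∈ l`, but not `i * g` for `0 < i < q`, since `q` does not
    -- divide `m`.
    let X : ℕ → ZMod n → Prop := fun i z => (m : ZMod n) * (z - x - i * g) = 0
    have hXinv : ∀ i, ∀ p ∈ l, ∀ z, X i (z + ((n / p : ℕ) : ZMod n)) ↔ X i z := by
      intro i p hp z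
      have : (m : ZMod n) * ((n / p : ℕ) : ZMod n) = 0 := by
        rw [← Nat.cast_mul, natCast_mul_div_eq_zero_iff (hl p (List.mem_cons_of_mem _ hp)).2]
        exact List.dvd_prod hp
      simp only [X]
      rw [show (m : ZMod n) * (z + ((n / p : ℕ) : ZMod n) - x - i * g) =
        (m : ZMod n) * (z - x - i * g) + (m : ZMod n) * ((n / p : ℕ) : ZMod n) by ring, this,
        add_zero]
    have hqm : ¬ q ∣ m := by
      intro hd
      obtain ⟨p, hp, hqp'⟩ := (Nat.Prime.prime hqp).dvd_prod_iff.1 hd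
      have := (Nat.prime_dvd_prime_iff_eq hqp (hl p (List.mem_cons_of_mem _ hp)).1).1 hqp'
      exact hql (this ▸ hp)
    -- some translate of the coset avoids the support of `f`
    obtain ⟨i, hi⟩ : ∃ i : Fin q, ∀ z, X i z → f z = 0 := by
      by_contra hcon
      push Not at hcon
      choose z hz hz0 using hcon
      have hinj : Function.Injective z := by
        have aux : ∀ i j : Fin q, i < j → z i ≠ z j := by
          intro i j hij he
          have h1 := hz i
          have h2 := hz j
          rw [← he] at h2
          simp only [X] at h1 h2
          have h3 : (m : ZMod n) * ((((j : ℕ) - (i : ℕ) : ℕ) : ZMod n) * g) = 0 := by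
            rw [Nat.cast_sub (by exact_mod_cast hij.le)]
            linear_combination h1 - h2
          rw [hg, ← Nat.cast_mul, ← Nat.cast_mul, ← mul_assoc,
            natCast_mul_div_eq_zero_iff hqn, hqp.dvd_mul] at h3
          rcases h3 with h3 | h3
          · exact hqm h3
          · have hij' : (i : ℕ) < j := hij
            have := Nat.le_of_dvd (by omega) h3
            have := j.2
            omega
        intro i j he
        rcases lt_trichotomy i j with hij | hij | hij
        · exact absurd he (aux i j hij)
        · exact hij
        · exact absurd he.symm (aux j i hij)
      have h1 : (q : ℤ) ≤ ∑ i : Fin q, |f (z i)| := by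
        calc (q : ℤ) = ∑ i : Fin q, (1 : ℤ) := by simp
          _ ≤ _ := Finset.sum_le_sum fun i _ => Int.one_le_abs (hz0 i)
      have h2 : ∑ i : Fin q, |f (z i)| ≤ ∑ x, |f x| := by
        rw [← Finset.sum_image (f := fun y => |f y|) (s := Finset.univ) (g := z) (by
          intro a _ b _ hab; exact hinj hab)]
        exact Finset.sum_le_sum_of_subset_of_nonneg (Finset.subset_univ _) fun _ _ _ => abs_nonneg _
      have := hf q List.mem_cons_self
      omega
    have hFi : ∀ z, X i z → F z = 0 := by
      intro z hz
      have h1 := iterDiff_indicator f (X i) l (hXinv i) z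
      have h2 : (fun y => if X i y then f y else 0) = fun _ => (0 : ℤ) := by
        ext y; split_ifs with hy
        · exact hi y hy
        · rfl
      have h3 : ∀ (l : List ℕ) (z : ZMod n), iterDiff l (fun _ => (0 : ℤ)) z = 0 := by
        intro l; induction l with
        | nil => intro z; rfl
        | cons a l ih => intro z; simp only [iterDiff, ih, sub_zero]
      rw [h2, h3, if_pos hz] at h1
      exact h1.symm
    have hF0 : ∀ z, X 0 z → F z = 0 := by
      intro z hz
      rw [← hper' i z]
      apply hFi
      simp only [X] at hz ⊢
      rw [← hz]; push_cast; ring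
    have hres := ih hnd (fun p hp => hl p (List.mem_cons_of_mem _ hp))
      (fun y => if X 0 y then f y else 0) (fun p hp => by
        refine lt_of_le_of_lt (Finset.sum_le_sum fun y _ => ?_) (hf p (List.mem_cons_of_mem _ hp))
        split_ifs <;> simp) (by
        ext z
        rw [iterDiff_indicator f (X 0) l (hXinv 0) z]
        split_ifs with hz
        · exact hF0 z hz
        · rfl)
    have := congrFun hres x
    rw [if_pos (by simp [X])] at this
    exact hx this

/-- A short integer relation between `n`-th roots of unity is trivial. -/
theorem eq_zero_of_charSum_one_eq_zero {n : ℕ} [NeZero n] (f : ZMod n → ℤ)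
    (hf : ∀ p : ℕ, p.Prime → p ∣ n → ∑ x, |f x| < p) (h : charSum f 1 = 0) : f = 0 := by
  refine eq_zero_of_iterDiff_eq_zero n.primeFactors.toList (Finset.nodup_toList _)
    (fun p hp => ?_) f (fun p hp => ?_) (charSum_injective fun a => charSum_iterDiff_eq_zero _ ?_)
  · rw [Finset.mem_toList, Nat.mem_primeFactors] at hp
    exact ⟨hp.1, hp.2.1⟩
  · rw [Finset.mem_toList, Nat.mem_primeFactors] at hp
    exact hf p hp.1 hp.2.1
  · by_cases ha : IsUnit a
    · exact Or.inl (charSum_eq_zero_of_isUnit h ha)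
    · right
      have hcop : ¬ Nat.Coprime a.val n := by
        intro hc
        apply ha
        rw [← ZMod.natCast_zmod_val a]
        exact (ZMod.isUnit_iff_coprime _ _).2 hc
      obtain ⟨p, hp, hpa, hpn⟩ := Nat.Prime.not_coprime_iff_dvd.1 hcop
      refine ⟨p, by simp [hp, hpn, NeZero.ne n], ?_⟩
      rw [mul_comm, ← ZMod.natCast_zmod_val a, ← Nat.cast_mul, natCast_mul_div_eq_zero_iff hpn]
      exact hpa

/-! ### Points of a field with equal differences -/

/-- The `m`-th power sum of a finite family. -/
def powerSum {ι F : Type*} [Fintype ι] [CommRing F] (x : ι → F) (m : ℕ) : F := ∑ i, x i ^ m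

/-- Turns moments of differences into power sums, which Newton's identities express through the
coefficients of the polynomial with these roots. -/
theorem sum_sub_pow_eq {ι F : Type*} [Fintype ι] [CommRing F] (x : ι → F) (N : ℕ) :
    ∑ q : ι × ι, (x q.1 - x q.2) ^ N =
      ∑ l ∈ Finset.range (N + 1),
        (-1) ^ (N - l) * (N.choose l : F) * (powerSum x l * powerSum x (N - l)) := by
  rw [Fintype.sum_prod_type]
  simp only [sub_eq_add_neg, add_pow, powerSum, Fintype.sum_mul_sum]
  simp only [Finset.mul_sum]
  rw [Finset.sum_congr rfl fun i _ => Finset.sum_comm, Finset.sum_comm]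
  refine Finset.sum_congr rfl fun l _ => Finset.sum_congr rfl fun i _ =>
    Finset.sum_congr rfl fun j _ => ?_
  rw [neg_pow]
  ring

open Polynomial in
theorem exists_quartic_of_sum_eq_zero {F : Type*} [Field F] (x : Fin 4 → F) (hx : ∑ i, x i = 0) :
    ∃ a b c : F, ∏ i, (X - C (x i)) = X ^ 4 + C a * X ^ 2 + C b * X + C c ∧
      powerSum x 0 = 4 ∧ powerSum x 1 = 0 ∧ powerSum x 2 = -2 * a ∧ powerSum x 3 = -3 * b ∧
      ∀ m, powerSum x (m + 4) =
        -(a * powerSum x (m + 2) + b * powerSum x (m + 1) + c * powerSum x m) := by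
  have h : x 0 + x 1 + x 2 + x 3 = 0 := by rw [← hx, Fin.sum_univ_four]
  have h3 : x 3 = -(x 0 + x 1 + x 2) := by linear_combination h
  let a := x 0 * x 1 + x 0 * x 2 + x 0 * x 3 + x 1 * x 2 + x 1 * x 3 + x 2 * x 3
  let b := -(x 0 * x 1 * x 2 + x 0 * x 1 * x 3 + x 0 * x 2 * x 3 + x 1 * x 2 * x 3)
  let c := x 0 * x 1 * x 2 * x 3
  have hP : ∏ i, (X - C (x i)) = X ^ 4 + C a * X ^ 2 + C b * X + C c := by
    simp only [Fin.prod_univ_four, a, b, c, h3, C_neg, C_add, C_mul]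
    ring
  refine ⟨a, b, c, hP, by simp [powerSum], by simpa [powerSum] using hx, ?_, ?_, fun m => ?_⟩
  · simp only [powerSum, Fin.sum_univ_four, a, h3]; ring
  · simp only [powerSum, Fin.sum_univ_four, b, h3]; ring
  · have root (i : Fin 4) : x i ^ 4 + a * x i ^ 2 + b * x i + c = 0 := by
      have := congrArg (eval (x i)) hP
      simp only [eval_prod, eval_sub, eval_add, eval_mul, eval_pow, eval_X, eval_C] at this
      rw [← this]
      exact Finset.prod_eq_zero (Finset.mem_univ i) (sub_self _)
    simp only [powerSum, Finset.mul_sum, ← Finset.sum_add_distrib, ← Finset.sum_neg_distrib]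
    refine Finset.sum_congr rfl fun i _ => ?_
    linear_combination x i ^ m * root i

open Polynomial in
theorem exists_quintic_of_sum_eq_zero {F : Type*} [Field F] (x : Fin 5 → F) (hx : ∑ i, x i = 0) :
    ∃ a b c d : F, ∏ i, (X - C (x i)) = X ^ 5 + C a * X ^ 3 + C b * X ^ 2 + C c * X + C d ∧
      powerSum x 0 = 5 ∧ powerSum x 1 = 0 ∧ powerSum x 2 = -2 * a ∧ powerSum x 3 = -3 * b ∧
      powerSum x 4 = 2 * a ^ 2 - 4 * c ∧
      ∀ m, powerSum x (m + 5) = -(a * powerSum x (m + 3) + b * powerSum x (m + 2) +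
        c * powerSum x (m + 1) + d * powerSum x m) := by
  have h : x 0 + x 1 + x 2 + x 3 + x 4 = 0 := by rw [← hx, Fin.sum_univ_five]
  have h4 : x 4 = -(x 0 + x 1 + x 2 + x 3) := by linear_combination h
  let a := x 0 * x 1 + x 0 * x 2 + x 0 * x 3 + x 0 * x 4 + x 1 * x 2 + x 1 * x 3 + x 1 * x 4 +
    x 2 * x 3 + x 2 * x 4 + x 3 * x 4
  let b := -(x 0 * x 1 * x 2 + x 0 * x 1 * x 3 + x 0 * x 1 * x 4 + x 0 * x 2 * x 3 +
    x 0 * x 2 * x 4 + x 0 * x 3 * x 4 + x 1 * x 2 * x 3 + x 1 * x 2 * x 4 + x 1 * x 3 * x 4 +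
    x 2 * x 3 * x 4)
  let c := x 0 * x 1 * x 2 * x 3 + x 0 * x 1 * x 2 * x 4 + x 0 * x 1 * x 3 * x 4 +
    x 0 * x 2 * x 3 * x 4 + x 1 * x 2 * x 3 * x 4
  let d := -(x 0 * x 1 * x 2 * x 3 * x 4)
  have hP : ∏ i, (X - C (x i)) = X ^ 5 + C a * X ^ 3 + C b * X ^ 2 + C c * X + C d := by
    simp only [Fin.prod_univ_five, a, b, c, d, h4, C_neg, C_add, C_mul]
    ring
  refine ⟨a, b, c, d, hP, by simp [powerSum], by simpa [powerSum] using hx, ?_, ?_, ?_,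
    fun m => ?_⟩
  · simp only [powerSum, Fin.sum_univ_five, a, h4]; ring
  · simp only [powerSum, Fin.sum_univ_five, b, h4]; ring
  · simp only [powerSum, Fin.sum_univ_five, a, c, h4]; ring
  · have root (i : Fin 5) : x i ^ 5 + a * x i ^ 3 + b * x i ^ 2 + c * x i + d = 0 := by
      have := congrArg (eval (x i)) hP
      simp only [eval_prod, eval_sub, eval_add, eval_mul, eval_pow, eval_X, eval_C] at this
      rw [← this]
      exact Finset.prod_eq_zero (Finset.mem_univ i) (sub_self _)
    simp only [powerSum, Finset.mul_sum, ← Finset.sum_add_distrib, ← Finset.sum_neg_distrib]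
    refine Finset.sum_congr rfl fun i _ => ?_
    linear_combination x i ^ m * root i

theorem exists_perm_of_card_fiber_eq {ι α : Type*} [Fintype ι] [DecidableEq α] {x y : ι → α}
    (h : ∀ a, (Finset.univ.filter fun i => x i = a).card =
      (Finset.univ.filter fun i => y i = a).card) :
    ∃ σ : Equiv.Perm ι, ∀ i, x i = y (σ i) := by
  have e : ∀ a, Nonempty ({i // x i = a} ≃ {i // y i = a}) := fun a => by
    rw [← Fintype.card_eq, Fintype.card_subtype, Fintype.card_subtype]
    exact h a
  refine ⟨(Equiv.sigmaFiberEquiv x).symm.trans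
    ((Equiv.sigmaCongrRight fun a => (e a).some).trans (Equiv.sigmaFiberEquiv y)), fun i => ?_⟩
  exact (((e (x i)).some ⟨i, rfl⟩).2).symm

open Polynomial in
theorem exists_perm_of_prod_X_sub_C_eq {F ι : Type*} [Field F] [Fintype ι] {x y : ι → F}
    (h : ∏ i, (X - C (x i)) = ∏ i, (X - C (y i))) : ∃ σ : Equiv.Perm ι, ∀ i, x i = y (σ i) := by
  classical
  have key (z : ι → F) : (∏ i, (X - C (z i))).roots = Finset.univ.val.map z := by
    have := roots_multiset_prod_X_sub_C (Finset.univ.val.map z)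
    rw [Multiset.map_map] at this
    exact this
  have h2 : Finset.univ.val.map x = Finset.univ.val.map y := by rw [← key, ← key, h]
  refine exists_perm_of_card_fiber_eq fun a => ?_
  have := congrArg (Multiset.count a) h2
  simpa only [Multiset.count_map, Finset.card_def, Finset.filter_val, eq_comm (a := a)] using this

open Polynomial in
theorem prod_X_sub_C_neg {F ι : Type*} [Field F] [Fintype ι] (y : ι → F) :
    ∏ i, (X - C (-y i)) = (-1) ^ Fintype.card ι * (∏ i, (X - C (y i))).comp (-X) := by
  rw [Polynomial.prod_comp, ← Finset.card_univ, ← Finset.prod_const, ← Finset.prod_mul_distrib]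
  refine Finset.prod_congr rfl fun i _ => ?_
  simp
  ring

/-- The squares give each sign separately; the product forces a common sign unless one entry is
zero, in which case its sign is free. -/
theorem exists_sign_of_sq_eq {F : Type*} [Field F] {b d b' d' : F} (hb : b ^ 2 = b' ^ 2)
    (hd : d ^ 2 = d' ^ 2) (hbd : b * d = b' * d') :
    ∃ ε : ℤ, (ε = 1 ∨ ε = -1) ∧ b = ε * b' ∧ d = ε * d' := by
  rcases sq_eq_sq_iff_eq_or_eq_neg.1 hb with rfl | rfl
  · by_cases h0 : b = 0
    · subst h0
      rcases sq_eq_sq_iff_eq_or_eq_neg.1 hd with rfl | rfl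
      · exact ⟨1, by simp⟩
      · exact ⟨-1, by simp⟩
    · exact ⟨1, Or.inl rfl, by simp, by simpa using mul_left_cancel₀ h0 hbd⟩
  · by_cases h0 : b' = 0
    · subst h0
      rcases sq_eq_sq_iff_eq_or_eq_neg.1 hd with rfl | rfl
      · exact ⟨1, by simp⟩
      · exact ⟨-1, by simp⟩
    · refine ⟨-1, Or.inr rfl, by simp, mul_left_cancel₀ h0 ?_⟩
      push_cast
      linear_combination -hbd

open Polynomial in
theorem quartic_homometric {F : Type*} [Field F] (h2 : (2 : F) ≠ 0) (h3 : (3 : F) ≠ 0)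
    (h13 : (13 : F) ≠ 0) (x y : Fin 4 → F) (hx : ∑ i, x i = 0) (hy : ∑ i, y i = 0)
    (h : ∀ N, ∑ q : Fin 4 × Fin 4, (x q.1 - x q.2) ^ N =
      ∑ q : Fin 4 × Fin 4, (y q.1 - y q.2) ^ N) :
    ∃ (ε : ℤ) (σ : Equiv.Perm (Fin 4)), (ε = 1 ∨ ε = -1) ∧ ∀ i, x i = ε * y (σ i) := by
  obtain ⟨a, b, c, hP, p0, p1, p2, p3, hp⟩ := exists_quartic_of_sum_eq_zero x hx
  have p4 : powerSum x 4 = -(a * powerSum x 2 + b * powerSum x 1 + c * powerSum x 0) := hp 0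
  have p5 : powerSum x 5 = -(a * powerSum x 3 + b * powerSum x 2 + c * powerSum x 1) := hp 1
  have p6 : powerSum x 6 = -(a * powerSum x 4 + b * powerSum x 3 + c * powerSum x 2) := hp 2
  obtain ⟨a', b', c', hP', p0', p1', p2', p3', hp'⟩ := exists_quartic_of_sum_eq_zero y hy
  have p4' : powerSum y 4 = -(a' * powerSum y 2 + b' * powerSum y 1 + c' * powerSum y 0) := hp' 0
  have p5' : powerSum y 5 = -(a' * powerSum y 3 + b' * powerSum y 2 + c' * powerSum y 1) := hp' 1
  have p6' : powerSum y 6 = -(a' * powerSum y 4 + b' * powerSum y 3 + c' * powerSum y 2) := hp' 2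
  have e2 := h 2
  have e4 := h 4
  have e6 := h 6
  rw [sum_sub_pow_eq, sum_sub_pow_eq] at e2 e4 e6
  simp only [Finset.sum_range_succ, Finset.sum_range_zero, Nat.reduceAdd, Nat.reduceSub,
    Nat.choose, p0, p1, p2, p3, p4, p5, p6, p0', p1', p2', p3', p4', p5', p6'] at e2 e4 e6
  -- The moments of order 2 and 4 are `-16a` and `40a² - 32c`; in order 6, `b²` has coefficient
  -- `-156 = -2²·3·13`, whence the condition on 13. Only the sign of `b` stays open, and reflecting
  -- `y` flips it.
  have ha : a = a' := by
    refine mul_left_cancel₀ (pow_ne_zero 4 h2) ?_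
    linear_combination -e2
  subst ha
  have hc : c = c' := by
    refine mul_left_cancel₀ (pow_ne_zero 5 h2) ?_
    linear_combination -e4
  subst hc
  have hb : b ^ 2 = b' ^ 2 := by
    refine mul_left_cancel₀ (mul_ne_zero (mul_ne_zero (pow_ne_zero 2 h2) h3) h13) ?_
    linear_combination -e6
  obtain ⟨ε, hε, hbε, -⟩ := exists_sign_of_sq_eq hb (d := 0) (d' := 0) rfl (by simp)
  have hpoly : ∏ i, (X - C (x i)) = ∏ i, (X - C ((ε : F) * y i)) := by
    rcases hε with rfl | rfl
    · simp [hP, hP', hbε]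
    · simp only [Int.cast_neg, Int.cast_one, neg_one_mul, prod_X_sub_C_neg, hP, hP', hbε]
      simp
      ring
  obtain ⟨σ, hσ⟩ := exists_perm_of_prod_X_sub_C_eq hpoly
  exact ⟨ε, σ, hε, hσ⟩

open Polynomial in
theorem quintic_homometric {F : Type*} [Field F] (h2 : (2 : F) ≠ 0) (h3 : (3 : F) ≠ 0)
    (h5 : (5 : F) ≠ 0) (x y : Fin 5 → F) (hx : ∑ i, x i = 0) (hy : ∑ i, y i = 0)
    (h : ∀ N, ∑ q : Fin 5 × Fin 5, (x q.1 - x q.2) ^ N =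
      ∑ q : Fin 5 × Fin 5, (y q.1 - y q.2) ^ N) :
    ∃ (ε : ℤ) (σ : Equiv.Perm (Fin 5)), (ε = 1 ∨ ε = -1) ∧ ∀ i, x i = ε * y (σ i) := by
  obtain ⟨a, b, c, d, hP, p0, p1, p2, p3, p4, hp⟩ := exists_quintic_of_sum_eq_zero x hx
  have p5 : powerSum x 5 =
    -(a * powerSum x 3 + b * powerSum x 2 + c * powerSum x 1 + d * powerSum x 0) := hp 0
  have p6 : powerSum x 6 =
    -(a * powerSum x 4 + b * powerSum x 3 + c * powerSum x 2 + d * powerSum x 1) := hp 1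
  have p7 : powerSum x 7 =
    -(a * powerSum x 5 + b * powerSum x 4 + c * powerSum x 3 + d * powerSum x 2) := hp 2
  have p8 : powerSum x 8 =
    -(a * powerSum x 6 + b * powerSum x 5 + c * powerSum x 4 + d * powerSum x 3) := hp 3
  have p9 : powerSum x 9 =
    -(a * powerSum x 7 + b * powerSum x 6 + c * powerSum x 5 + d * powerSum x 4) := hp 4
  have p10 : powerSum x 10 =
    -(a * powerSum x 8 + b * powerSum x 7 + c * powerSum x 6 + d * powerSum x 5) := hp 5
  obtain ⟨a', b', c', d', hP', p0', p1', p2', p3', p4', hp'⟩ := exists_quintic_of_sum_eq_zero y hy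
  have p5' : powerSum y 5 =
    -(a' * powerSum y 3 + b' * powerSum y 2 + c' * powerSum y 1 + d' * powerSum y 0) := hp' 0
  have p6' : powerSum y 6 =
    -(a' * powerSum y 4 + b' * powerSum y 3 + c' * powerSum y 2 + d' * powerSum y 1) := hp' 1
  have p7' : powerSum y 7 =
    -(a' * powerSum y 5 + b' * powerSum y 4 + c' * powerSum y 3 + d' * powerSum y 2) := hp' 2
  have p8' : powerSum y 8 =
    -(a' * powerSum y 6 + b' * powerSum y 5 + c' * powerSum y 4 + d' * powerSum y 3) := hp' 3
  have p9' : powerSum y 9 =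
    -(a' * powerSum y 7 + b' * powerSum y 6 + c' * powerSum y 5 + d' * powerSum y 4) := hp' 4
  have p10' : powerSum y 10 =
    -(a' * powerSum y 8 + b' * powerSum y 7 + c' * powerSum y 6 + d' * powerSum y 5) := hp' 5
  have e2 := h 2
  have e4 := h 4
  have e6 := h 6
  have e8 := h 8
  have e10 := h 10
  rw [sum_sub_pow_eq, sum_sub_pow_eq] at e2 e4 e6 e8 e10
  simp only [Finset.sum_range_succ, Finset.sum_range_zero, Nat.reduceAdd, Nat.reduceSub,
    Nat.choose, p0, p1, p2, p3, p4, p5, p6, p7, p8, p9, p10,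
    p0', p1', p2', p3', p4', p5', p6', p7', p8', p9', p10'] at e2 e4 e6 e8 e10
  -- The moments of order 2, 4, 6, 8, 10 successively yield `a`, `c`, `b²`, `bd`, `d²`; the
  -- multiples of earlier identities remove lower terms. Reflection flips `b` and `d` together, so
  -- `bd` is needed to tie their signs.
  have ha : a = a' := by
    refine mul_left_cancel₀ (mul_ne_zero (pow_ne_zero 2 h2) h5) ?_
    linear_combination -e2
  subst ha
  have hc : c = c' := by
    refine mul_left_cancel₀ (mul_ne_zero (pow_ne_zero 3 h2) h5) ?_
    linear_combination -e4
  subst hc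
  have hb : b ^ 2 = b' ^ 2 := by
    refine mul_left_cancel₀ (mul_ne_zero (mul_ne_zero h2 h3) (pow_ne_zero 2 h5)) ?_
    linear_combination -e6
  have hbd : b * d = b' * d' := by
    refine mul_left_cancel₀ (mul_ne_zero (pow_ne_zero 6 h2) (pow_ne_zero 2 h5)) ?_
    linear_combination -e8 + 1264 * a * hb
  have hd : d ^ 2 = d' ^ 2 := by
    refine mul_left_cancel₀ (mul_ne_zero h2 (pow_ne_zero 5 h5)) ?_
    linear_combination -e10 + 16000 * a * hbd - (7230 * a ^ 2 + 100 * c) * hb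
  obtain ⟨ε, hε, hbε, hdε⟩ := exists_sign_of_sq_eq hb hd hbd
  have hpoly : ∏ i, (X - C (x i)) = ∏ i, (X - C ((ε : F) * y i)) := by
    rcases hε with rfl | rfl
    · simp [hP, hP', hbε, hdε]
    · simp only [Int.cast_neg, Int.cast_one, neg_one_mul, prod_X_sub_C_neg, hP, hP', hbε, hdε]
      simp
      ring
  obtain ⟨σ, hσ⟩ := exists_perm_of_prod_X_sub_C_eq hpoly
  exact ⟨ε, σ, hε, hσ⟩

/-- Over a field of characteristic zero or large characteristic, at most five points are determined
by their differences up to translation and reflection. -/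
theorem homometric_of_field {k : ℕ} (hk : k = 4 ∨ k = 5) {F : Type*} [Field F]
    (hF : ∀ m : ℕ, 0 < m → m ≤ 2 * k * (k - 1) → (m : F) ≠ 0) (x y : Fin k → F)
    (φ : Equiv.Perm (Fin k × Fin k))
    (h : ∀ q, x q.1 - x q.2 = y (φ q).1 - y (φ q).2) :
    ∃ (ε : ℤ) (σ : Equiv.Perm (Fin k)) (v : F), (ε = 1 ∨ ε = -1) ∧ ∀ i, x i = ε * y (σ i) + v := by
  have hk0 : (k : F) ≠ 0 := hF k (by omega) (by rcases hk with rfl | rfl <;> norm_num)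
  have center (z : Fin k → F) : ∑ i, (z i - (∑ j, z j) / k) = 0 := by
    rw [Finset.sum_sub_distrib]
    simp [mul_div_cancel₀ _ hk0]
  have hmom (N : ℕ) : ∑ q : Fin k × Fin k,
      ((x q.1 - (∑ j, x j) / k) - (x q.2 - (∑ j, x j) / k)) ^ N =
      ∑ q : Fin k × Fin k, ((y q.1 - (∑ j, y j) / k) - (y q.2 - (∑ j, y j) / k)) ^ N := by
    rw [← Equiv.sum_comp φ (fun q => ((y q.1 - (∑ j, y j) / k) - (y q.2 - (∑ j, y j) / k)) ^ N)]
    refine Finset.sum_congr rfl fun q _ => ?_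
    rw [sub_sub_sub_cancel_right, sub_sub_sub_cancel_right, h]
  have key : ∃ (ε : ℤ) (σ : Equiv.Perm (Fin k)), (ε = 1 ∨ ε = -1) ∧
      ∀ i, x i - (∑ j, x j) / k = ε * (y (σ i) - (∑ j, y j) / k) := by
    have n2 : (2 : F) ≠ 0 := by
      exact_mod_cast hF 2 (by norm_num) (by rcases hk with rfl | rfl <;> norm_num)
    have n3 : (3 : F) ≠ 0 := by
      exact_mod_cast hF 3 (by norm_num) (by rcases hk with rfl | rfl <;> norm_num)
    rcases hk with rfl | rfl
    · have n13 : (13 : F) ≠ 0 := by exact_mod_cast hF 13 (by norm_num) (by norm_num)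
      exact quartic_homometric n2 n3 n13 _ _ (center x) (center y) hmom
    · have n5 : (5 : F) ≠ 0 := by exact_mod_cast hF 5 (by norm_num) (by norm_num)
      exact quintic_homometric n2 n3 n5 _ _ (center x) (center y) hmom
  obtain ⟨ε, σ, hε, hσ⟩ := key
  exact ⟨ε, σ, (∑ j, x j) / k - ε * ((∑ j, y j) / k), hε, fun i => by
    linear_combination hσ i⟩

/-! ### Lifting coincidences of differences to the integers -/

open Matrix in
/-- Hadamard's determinant bound for matrices whose rows have squared length at most `c`. -/
theorem det_sq_le_pow {ι : Type*} [Fintype ι] [DecidableEq ι] (A : Matrix ι ι ℝ) {c : ℝ}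
    (hA : ∀ i, ∑ j, A i j ^ 2 ≤ c) : A.det ^ 2 ≤ c ^ Fintype.card ι := by
  have hps : (A * Aᴴ).PosSemidef := Matrix.posSemidef_self_mul_conjTranspose A
  have hdet : A.det ^ 2 = (A * Aᴴ).det := by
    rw [Matrix.det_mul, Matrix.conjTranspose_eq_transpose_of_trivial, Matrix.det_transpose, sq]
  have htr : (A * Aᴴ).trace ≤ Fintype.card ι * c := by
    rw [← nsmul_eq_mul, ← Finset.card_univ]
    refine Finset.sum_le_card_nsmul _ _ _ fun i _ => ?_
    simpa [Matrix.mul_apply, sq] using hA i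
  rw [hps.1.trace_eq_sum_eigenvalues] at htr
  rw [hdet, hps.1.det_eq_prod_eigenvalues]
  simp only [RCLike.ofReal_real_eq_id, id] at htr ⊢
  rcases isEmpty_or_nonempty ι with h | h
  · simp
  have hcard : (0 : ℝ) < Fintype.card ι := by exact_mod_cast Fintype.card_pos
  have hnn := hps.eigenvalues_nonneg
  -- AM-GM on the eigenvalues of `A * Aᴴ`: their product is `A.det ^ 2` and their mean is at most
  -- `c`.
  have hamgm := Real.geom_mean_le_arith_mean Finset.univ (fun _ : ι => (1 : ℝ))
    hps.1.eigenvalues (fun _ _ => zero_le_one) (by simpa using hcard) (fun i _ => hnn i)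
  simp only [Real.rpow_one, Finset.sum_const, Finset.card_univ, nsmul_eq_mul, mul_one, one_mul]
    at hamgm
  have hprod : 0 ≤ ∏ i, hps.1.eigenvalues i := Finset.prod_nonneg fun i _ => hnn i
  calc ∏ i, hps.1.eigenvalues i
      = ((∏ i, hps.1.eigenvalues i) ^ ((Fintype.card ι : ℝ)⁻¹)) ^ Fintype.card ι :=
        (Real.rpow_inv_natCast_pow hprod Fintype.card_ne_zero).symm
    _ ≤ c ^ Fintype.card ι := by
        refine pow_le_pow_left₀ (Real.rpow_nonneg hprod _) (hamgm.trans ?_) _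
        rw [div_le_iff₀ hcard]
        linarith

theorem int_det_sq_le_pow {ι : Type*} [Fintype ι] [DecidableEq ι] (A : Matrix ι ι ℤ) {c : ℤ}
    (hA : ∀ i, ∑ j, A i j ^ 2 ≤ c) : A.det ^ 2 ≤ c ^ Fintype.card ι := by
  have h := det_sq_le_pow (A.map (Int.cast : ℤ → ℝ)) (c := c) fun i => by
    simpa using (Int.cast_le (R := ℝ)).2 (hA i)
  have h2 : (A.map (Int.cast : ℤ → ℝ)).det = (A.det : ℝ) := by
    have := (Int.castRingHom ℝ).map_det A
    simpa using this.symm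
  rw [h2] at h
  exact_mod_cast h

open Matrix in
/-- A maximal nonvanishing minor of an integer matrix. -/
theorem exists_maximal_minor {κ : Type*} [Finite κ] {k : ℕ} (M : Matrix κ (Fin k) ℤ) :
    ∃ (ι : Type) (_ : Fintype ι) (_ : DecidableEq ι) (f : ι → κ) (g : ι → Fin k),
      Function.Injective g ∧ (M.submatrix f g).det ≠ 0 ∧
      ∀ z : Fin k → ℤ, (∀ i, M (f i) ⬝ᵥ z = 0) → ∀ e, M e ⬝ᵥ z = 0 := by
  classical
  obtain ⟨m, ⟨eκ⟩⟩ := Finite.exists_equiv_fin κ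
  let N : Matrix (Fin m) (Fin k) ℚ := fun i j => M (eκ.symm i) j
  -- A row basis, then a column basis of those rows: the minor is square because row and column rank
  -- agree, and the other rows lie in the rational span of the chosen ones.
  obtain ⟨ι, a, ha, hspan, hli⟩ := exists_linearIndependent' ℚ (fun i => N i)
  have : Finite ι := Finite.of_injective a ha
  have := Fintype.ofFinite ι
  let N' : Matrix ι (Fin k) ℚ := fun i j => N (a i) j
  obtain ⟨ι', b, hb, hspan', hli'⟩ := exists_linearIndependent' ℚ (fun j => N'.col j)
  have : Finite ι' := Finite.of_injective b hb
  have := Fintype.ofFinite ι'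
  have hcard : Fintype.card ι = Fintype.card ι' := by
    rw [← finrank_span_eq_card hli, ← finrank_span_eq_card hli', hspan',
      ← N'.rank_eq_finrank_span_cols, N'.rank_eq_finrank_span_row]
    rfl
  let e : ι ≃ ι' := Fintype.equivOfCardEq hcard
  refine ⟨ι, inferInstance, inferInstance, fun i => eκ.symm (a i), b ∘ e,
    hb.comp e.injective, ?_, ?_⟩
  · set D := M.submatrix (fun i => eκ.symm (a i)) (b ∘ e) with hD
    have hu : IsUnit (D.map (Int.cast : ℤ → ℚ)) := by
      rw [← Matrix.linearIndependent_cols_iff_isUnit]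
      exact hli'.comp e e.injective
    rw [Matrix.isUnit_iff_isUnit_det, isUnit_iff_ne_zero] at hu
    intro h0
    apply hu
    have := (Int.castRingHom ℚ).map_det D
    rw [h0] at this
    simpa using this.symm
  · intro z hz r
    let L : (Fin k → ℚ) →ₗ[ℚ] ℚ := ∑ j, (z j : ℚ) • LinearMap.proj j
    have hL (i : Fin m) : L (N i) = ((M (eκ.symm i) ⬝ᵥ z : ℤ) : ℚ) := by
      simp [L, N, dotProduct, mul_comm]
    have hle : Submodule.span ℚ (Set.range fun i => N i) ≤ LinearMap.ker L := by
      rw [← hspan, Submodule.span_le]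
      rintro _ ⟨i, rfl⟩
      simp only [SetLike.mem_coe, LinearMap.mem_ker, Function.comp]
      rw [hL, hz, Int.cast_zero]
    have := hle (Submodule.subset_span ⟨eκ r, rfl⟩)
    rw [LinearMap.mem_ker, hL, Equiv.symm_apply_apply] at this
    exact_mod_cast this

open Matrix in
/-- Solutions modulo `p` of a homogeneous system with short rows lift to integer solutions. -/
theorem exists_lift_of_short_rows {κ : Type*} [Finite κ] {k p : ℕ} (hp : p.Prime)
    (hk : 0 < k) {c : ℤ} (hc : 1 ≤ c) (hcp : c ^ (k - 1) < (p : ℤ) ^ 2) (M : Matrix κ (Fin k) ℤ)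
    (hsum : ∀ e, ∑ j, M e j = 0) (hnorm : ∀ e, ∑ j, M e j ^ 2 ≤ c) (y : Fin k → ℤ)
    (hy : ∀ e, (p : ℤ) ∣ M e ⬝ᵥ y) :
    ∃ z : Fin k → ℤ, (∀ e, M e ⬝ᵥ z = 0) ∧ ∀ j, (p : ℤ) ∣ y j - z j := by
  obtain ⟨ι, _, _, f, g, hg, hdet, hmax⟩ := exists_maximal_minor M
  set D := M.submatrix f g with hD
  -- The rows sum to zero, so a minor using all `k` columns would kill the all-ones vector.
  have hcard : Fintype.card ι ≤ k - 1 := by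
    have h1 : Fintype.card ι ≤ k := by simpa using Fintype.card_le_of_injective g hg
    by_contra hcon
    have hbij : Function.Bijective g :=
      (Fintype.bijective_iff_injective_and_card g).2 ⟨hg, by simp; omega⟩
    apply hdet
    rw [← Matrix.exists_mulVec_eq_zero_iff]
    have : Nonempty ι := Fintype.card_pos_iff.1 (by omega)
    refine ⟨fun _ => 1, fun h => one_ne_zero (congrFun h (Classical.arbitrary ι)), ?_⟩
    ext i
    simp only [Matrix.mulVec, dotProduct, mul_one, hD, Matrix.submatrix_apply, Pi.zero_apply]
    rw [← hsum (f i)]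
    exact (Equiv.ofBijective g hbij).sum_comp (fun j => M (f i) j)
  have hDsq : D.det ^ 2 < (p : ℤ) ^ 2 := by
    refine lt_of_le_of_lt (int_det_sq_le_pow D (c := c) fun i => ?_)
      (lt_of_le_of_lt (pow_le_pow_right₀ hc hcard) hcp)
    refine le_trans ?_ (hnorm (f i))
    simp only [hD, Matrix.submatrix_apply]
    rw [← Finset.sum_image (f := fun j => M (f i) j ^ 2) (s := Finset.univ) (g := g)
      (fun a _ b _ hab => hg hab)]
    exact Finset.sum_le_sum_of_subset_of_nonneg (Finset.subset_univ _) fun _ _ _ => sq_nonneg _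
  have hpd : ¬ (p : ℤ) ∣ D.det := by
    intro h
    have h1 := Int.le_of_dvd (by positivity) (pow_dvd_pow_of_dvd h 2)
    omega
  choose w hw using fun i => hy (f i)
  -- Cramer's rule without division: `u'` corrects `D.det • y` to an exact solution `z'`, congruent
  -- to `D.det • y` modulo `p`. Multiplying by an inverse of the determinant modulo `p` then
  -- recovers `y`.
  let u : ι → ℤ := D.adjugate *ᵥ w
  let u' : Fin k → ℤ := ∑ i, u i • Pi.single (g i) 1
  let z' : Fin k → ℤ := D.det • y - (p : ℤ) • u'
  have hz' : ∀ e, M e ⬝ᵥ z' = 0 := by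
    apply hmax
    intro i
    have h1 : M (f i) ⬝ᵥ u' = D.det * w i := by
      have h2 : D *ᵥ u = D.det • w := by
        simp only [u, Matrix.mulVec_mulVec, Matrix.mul_adjugate, Matrix.smul_mulVec,
          Matrix.one_mulVec]
      have h3 := congrFun h2 i
      rw [Pi.smul_apply, smul_eq_mul] at h3
      rw [← h3]
      have h4 : M (f i) ⬝ᵥ u' = ∑ c, u c * M (f i) (g c) := by
        simp only [u', dotProduct_sum, dotProduct_smul, dotProduct_single, smul_eq_mul, mul_one]
      rw [h4]
      simp only [Matrix.mulVec, dotProduct, hD, Matrix.submatrix_apply]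
      exact Finset.sum_congr rfl fun _ _ => mul_comm _ _
    simp only [z', dotProduct_sub, dotProduct_smul, smul_eq_mul, h1, hw i]
    ring
  have hcop : IsCoprime (D.det) (p : ℤ) :=
    ((Nat.prime_iff_prime_int.1 hp).coprime_iff_not_dvd.2 hpd).symm
  obtain ⟨a, b, hab⟩ := hcop
  refine ⟨a • z', fun e => by rw [dotProduct_smul, hz', smul_zero], fun j => ?_⟩
  refine ⟨b * y j + a * u' j, ?_⟩
  simp only [z', Pi.smul_apply, Pi.sub_apply, smul_eq_mul]
  linear_combination -y j * hab

open Matrix in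
/-- The coincidence `y i - y j = y a - y b` of two differences is, up to a factor `2`, a linear
relation with coefficient vector of squared length at most `6`. -/
theorem exists_short_difference_row {k : ℕ} (i j a b : Fin k) :
    ∃ (r : Fin k → ℤ) (c : ℤ), (c = 1 ∨ c = 2) ∧ ∑ l, r l = 0 ∧ ∑ l, r l ^ 2 ≤ 6 ∧
      ∀ y : Fin k → ℤ, y i - y j - (y a - y b) = c * (r ⬝ᵥ y) := by
  have hdot (r : Fin k → ℤ) : ∑ l, r l ^ 2 = r ⬝ᵥ r := by simp [dotProduct, sq]
  have hone (r : Fin k → ℤ) : ∑ l, r l = r ⬝ᵥ 1 := by simp [dotProduct]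
  -- Here the relation is `2(y i - y j)`, and the factor 2 must be removed: its squared length can
  -- be 8, and `8^4` exceeds `41²`.
  by_cases h : i = b ∧ j = a
  · obtain ⟨rfl, rfl⟩ := h
    refine ⟨Pi.single i 1 - Pi.single j 1, 2, Or.inr rfl, ?_, ?_, fun y => ?_⟩
    · rw [hone]
      simp [sub_dotProduct]
    · rw [hdot]
      simp only [sub_dotProduct, single_dotProduct, Pi.sub_apply, Pi.single_apply, one_mul]
      split_ifs <;> norm_num
    · simp [sub_dotProduct]
      ring
  · refine ⟨(Pi.single i 1 - Pi.single j 1) - (Pi.single a 1 - Pi.single b 1), 1, Or.inl rfl, ?_,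
      ?_, fun y => ?_⟩
    · rw [hone]
      simp [sub_dotProduct]
    · rw [hdot]
      simp only [sub_dotProduct, single_dotProduct, Pi.sub_apply, Pi.single_apply, one_mul,
        eq_comm (a := j) (b := i), eq_comm (a := a) (b := i), eq_comm (a := b) (b := i),
        eq_comm (a := a) (b := j), eq_comm (a := b) (b := j), eq_comm (a := b) (b := a), if_true]
      by_cases h1 : i = b
      · have h2 : j ≠ a := fun h2 => h ⟨h1, h2⟩
        simp only [h1, h2, if_true, if_false]
        split_ifs <;> norm_num
      · simp only [h1, if_false]
        split_ifs <;> norm_num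
    · simp [sub_dotProduct]

/-- The numerical margins are `6^3 = 216 < 25²` and `6^4 = 1296 < 41²`. -/
theorem two_mul_mul_pred_lt {k p : ℕ} (hk : k = 4 ∨ k = 5) (h : 2 * k * (k - 1) < p) :
    (6 : ℤ) ^ (k - 1) < (p : ℤ) ^ 2 := by
  have hp : (2 * k * (k - 1) : ℕ) + 1 ≤ (p : ℤ) := by exact_mod_cast h
  rcases hk with rfl | rfl <;> norm_num at hp ⊢ <;> nlinarith

-- The field case modulo `p` expresses `x` through `y`, so the coincidences become a system in `y`
-- alone, with rank at most `k - 1` and rows short enough to lift. Keeping the same `φ` makes the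
-- lift usable in an induction on `n`.
open Matrix in
theorem exists_lift_homometric_prime {k p : ℕ} (hk : k = 4 ∨ k = 5) (hp : p.Prime)
    (hkp : 2 * k * (k - 1) < p) (φ : Equiv.Perm (Fin k × Fin k)) (x y : Fin k → ℤ)
    (h : ∀ q, (p : ℤ) ∣ x q.1 - x q.2 - (y (φ q).1 - y (φ q).2)) :
    ∃ x' y' : Fin k → ℤ, (∀ q, x' q.1 - x' q.2 = y' (φ q).1 - y' (φ q).2) ∧
      ∀ i, (p : ℤ) ∣ x i - x' i ∧ (p : ℤ) ∣ y i - y' i := by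
  have := Fact.mk hp
  have hcast (a : ℤ) : ((a : ℤ) : ZMod p) = 0 ↔ (p : ℤ) ∣ a := ZMod.intCast_zmod_eq_zero_iff_dvd a p
  have hF : ∀ m : ℕ, 0 < m → m ≤ 2 * k * (k - 1) → (m : ZMod p) ≠ 0 := fun m h0 hm h1 => by
    rw [ZMod.natCast_eq_zero_iff] at h1
    have := Nat.le_of_dvd h0 h1
    omega
  obtain ⟨ε, σ, v, hε, hσ⟩ := homometric_of_field hk hF (fun i => (x i : ZMod p))
    (fun i => (y i : ZMod p)) φ (fun q => by
      have := (hcast _).2 (h q)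
      push_cast at this
      exact sub_eq_zero.1 this)
  obtain ⟨V, rfl⟩ := ZMod.intCast_surjective v
  have hrow : ∀ q : Fin k × Fin k, ∃ (r : Fin k → ℤ) (c : ℤ), (c = 1 ∨ c = 2) ∧ ∑ l, r l = 0 ∧
      ∑ l, r l ^ 2 ≤ 6 ∧ ∀ y : Fin k → ℤ,
        ε * (y (σ q.1) - y (σ q.2)) - (y (φ q).1 - y (φ q).2) = c * (r ⬝ᵥ y) := by
    intro q
    rcases hε with rfl | rfl
    · simpa using exists_short_difference_row (σ q.1) (σ q.2) (φ q).1 (φ q).2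
    · simpa using exists_short_difference_row (σ q.2) (σ q.1) (φ q).1 (φ q).2
  choose M c hc hsum hnorm hM using hrow
  have hdvd : ∀ q, (p : ℤ) ∣ M q ⬝ᵥ y := by
    intro q
    have h1 : (p : ℤ) ∣ c q * (M q ⬝ᵥ y) := by
      rw [← hM q y, ← hcast]
      have h2 := (hcast _).2 (h q)
      push_cast at h2 ⊢
      have e1 := hσ q.1
      have e2 := hσ q.2
      linear_combination h2 - e1 + e2
    refine (((Nat.prime_iff_prime_int.1 hp).dvd_mul).1 h1).resolve_left fun h2 => ?_
    have h3 : (p : ℤ) ≤ 2 := by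
      rcases hc q with h4 | h4 <;> rw [h4] at h2 <;>
        have := Int.le_of_dvd (by norm_num) h2 <;> omega
    rcases hk with rfl | rfl <;> omega
  obtain ⟨z, hz, hyz⟩ := exists_lift_of_short_rows hp (by omega) (by norm_num)
    (two_mul_mul_pred_lt hk hkp) M hsum hnorm y hdvd
  refine ⟨fun i => ε * z (σ i) + V, z, fun q => ?_, fun i => ⟨?_, hyz i⟩⟩
  · have := hM q z
    rw [hz q] at this
    linear_combination this
  · rw [← hcast]
    have h1 := hσ i
    have h2 := (hcast _).2 (hyz (σ i))
    push_cast at h2 ⊢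
    linear_combination h1 + ε * h2

/-- After subtracting an exact integer solution congruent modulo `p`, the remainder divided by `p`
satisfies the same system modulo `n / p`, since the system is linear. -/
theorem exists_lift_homometric {k n : ℕ} (hk : k = 4 ∨ k = 5) (hn0 : n ≠ 0)
    (hn : ∀ p : ℕ, p.Prime → p ∣ n → 2 * k * (k - 1) < p)
    (φ : Equiv.Perm (Fin k × Fin k)) (x y : Fin k → ℤ)
    (h : ∀ q, (n : ℤ) ∣ x q.1 - x q.2 - (y (φ q).1 - y (φ q).2)) :
    ∃ x' y' : Fin k → ℤ, (∀ q, x' q.1 - x' q.2 = y' (φ q).1 - y' (φ q).2) ∧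
      ∀ i, (n : ℤ) ∣ x i - x' i ∧ (n : ℤ) ∣ y i - y' i := by
  induction n using induction_on_primes generalizing x y with
  | zero => exact absurd rfl hn0
  | one => exact ⟨0, 0, fun _ => by simp, fun _ => by simp⟩
  | prime_mul p a hp ih =>
    obtain ⟨x₀, y₀, h₀, hd₀⟩ := exists_lift_homometric_prime hk hp (hn p hp (dvd_mul_right p a)) φ
      x y (fun q => (Int.natCast_dvd_natCast.2 (dvd_mul_right p a)).trans (h q))
    choose u hu using fun i => (hd₀ i).1
    choose w hw using fun i => (hd₀ i).2
    have hp0 : (p : ℤ) ≠ 0 := by exact_mod_cast hp.ne_zero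
    obtain ⟨x₁, y₁, h₁, hd₁⟩ := ih (right_ne_zero_of_mul hn0)
      (fun r hr hra => hn r hr (hra.mul_left p)) u w (fun q => by
        refine (mul_dvd_mul_iff_left hp0).1 ?_
        have h2 := h q
        push_cast at h2
        refine h2.trans (dvd_of_eq ?_)
        linear_combination hu q.1 - hu q.2 - hw (φ q).1 + hw (φ q).2 + h₀ q)
    refine ⟨fun i => x₀ i + p * x₁ i, fun i => y₀ i + p * y₁ i, fun q => ?_, fun i => ⟨?_, ?_⟩⟩
    · linear_combination h₀ q + p * h₁ q
    · have : x i - (x₀ i + p * x₁ i) = p * (u i - x₁ i) := by linear_combination hu i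
      push_cast
      rw [this]
      exact mul_dvd_mul_left _ (hd₁ i).1
    · have : y i - (y₀ i + p * y₁ i) = p * (w i - y₁ i) := by linear_combination hw i
      push_cast
      rw [this]
      exact mul_dvd_mul_left _ (hd₁ i).2

/-- Modulo `n` without small prime factors, at most five points are determined by their differences
up to translation and reflection. -/
theorem homometric_zmod {k n : ℕ} [NeZero n] (hk : k = 4 ∨ k = 5)
    (hn : ∀ p : ℕ, p.Prime → p ∣ n → 2 * k * (k - 1) < p)
    (φ : Equiv.Perm (Fin k × Fin k)) (x y : Fin k → ZMod n)
    (h : ∀ q, x q.1 - x q.2 = y (φ q).1 - y (φ q).2) :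
    ∃ (ε : ℤ) (σ : Equiv.Perm (Fin k)) (v : ZMod n), (ε = 1 ∨ ε = -1) ∧
      ∀ i, x i = ε * y (σ i) + v := by
  have hcast (a : ℤ) : ((a : ℤ) : ZMod n) = 0 ↔ (n : ℤ) ∣ a := ZMod.intCast_zmod_eq_zero_iff_dvd a n
  choose X hX using fun i => ZMod.intCast_surjective (x i)
  choose Y hY using fun i => ZMod.intCast_surjective (y i)
  obtain ⟨x', y', h', hd⟩ := exists_lift_homometric hk (NeZero.ne n) hn φ X Y (fun q => by
    rw [← hcast]
    push_cast
    rw [hX, hX, hY, hY, h, sub_self])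
  obtain ⟨ε, σ, v, hε, hσ⟩ := homometric_of_field hk
    (fun m hm _ => Nat.cast_ne_zero.2 hm.ne') (fun i => (x' i : ℚ)) (fun i => (y' i : ℚ)) φ
    (fun q => by exact_mod_cast h' q)
  have hx' (i) : x i = x' i := by
    have := (hcast _).2 (hd i).1
    push_cast at this
    rw [← hX, sub_eq_zero.1 this]
  have hy' (i) : y i = y' i := by
    have := (hcast _).2 (hd i).2
    push_cast at this
    rw [← hY, sub_eq_zero.1 this]
  -- The rational translation `v` is an integer, as it equals `x' i₀ - ε * y' (σ i₀)`.
  let i₀ : Fin k := ⟨0, by omega⟩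
  refine ⟨ε, σ, ((x' i₀ - ε * y' (σ i₀) : ℤ) : ZMod n), hε, fun i => ?_⟩
  have : x' i = ε * y' (σ i) + (x' i₀ - ε * y' (σ i₀)) := by
    have h1 := hσ i
    have h2 := hσ i₀
    have h3 : (x' i : ℚ) = ε * y' (σ i) + (x' i₀ - ε * y' (σ i₀)) := by linear_combination h1 - h2
    exact_mod_cast h3
  rw [hx', this, hy']
  push_cast
  ring

/-! ### Circulants and their spectra -/

theorem IsPermutationMatrix.mul_transpose {n : ℕ} [NeZero n] {P : Matrix (ZMod n) (ZMod n) ℂ}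
    (h : IsPermutationMatrix P) : P * P.transpose = 1 := by
  obtain ⟨σ, rfl⟩ := h
  rw [Matrix.transpose_permMatrix, ← Matrix.permMatrix_mul, inv_mul_cancel, Matrix.permMatrix_one]

theorem IsZeroOneCirculant.apply_eq {n : ℕ} {A : Matrix (ZMod n) (ZMod n) ℂ}
    (hA : IsZeroOneCirculant A) (i j : ZMod n) : A i j = A 0 (j - i) := by
  obtain ⟨v, rfl⟩ := hA.circulant
  simp [Matrix.circulant_apply]

theorem exists_permutation_of_affinelyEquivalent {n : ℕ} [NeZero n]
    {A B : Matrix (ZMod n) (ZMod n) ℂ} (hA : IsZeroOneCirculant A) (hB : IsZeroOneCirculant B)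
    (h : AffinelyEquivalent (residueSet A) (residueSet B)) :
    ∃ P Q : Matrix (ZMod n) (ZMod n) ℂ,
      IsPermutationMatrix P ∧ IsPermutationMatrix Q ∧ A = P * B * Q := by
  obtain ⟨_, v, ⟨u, rfl⟩, hS⟩ := h
  -- Chosen so that `j - i = u * (τ.symm j - σ i) + v`.
  let σ : Equiv.Perm (ZMod n) := Units.mulLeft u⁻¹
  let τ : Equiv.Perm (ZMod n) := (Units.mulLeft u).trans (Equiv.addRight v)
  refine ⟨σ.permMatrix ℂ, τ.permMatrix ℂ, ⟨σ, rfl⟩, ⟨τ, rfl⟩, ?_⟩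
  rw [PEquiv.toMatrix_toPEquiv_mul, PEquiv.mul_toMatrix_toPEquiv]
  ext i j
  simp only [Matrix.submatrix_apply, id]
  have hiff : A i j = 1 ↔ B (σ i) (τ.symm j) = 1 := by
    rw [hA.apply_eq, hB.apply_eq]
    change j - i ∈ residueSet A ↔ τ.symm j - σ i ∈ residueSet B
    have : j - i = u * (τ.symm j - σ i) + v := by
      simp [σ, τ, mul_sub]
      ring
    rw [hS, this]
    constructor
    · rintro ⟨t, ht, he⟩
      have : t = τ.symm j - σ i := u.isUnit.mul_left_cancel (add_right_cancel he)
      exact this ▸ ht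
    · exact fun ht => ⟨_, ht, rfl⟩
  rcases hA.zero_or_one i j with h0 | h0 <;>
    rcases hB.zero_or_one (σ i) (τ.symm j) with h1 | h1 <;> rw [h0, h1] <;>
    simp [h0, h1] at hiff

/-- Writes `A * A.transpose` as a sum of translations by differences of the residue set, the form in
which the characters are eigenvectors. -/
theorem exists_points {n k : ℕ} [NeZero n] {A : Matrix (ZMod n) (ZMod n) ℂ}
    (hA : IsZeroOneCirculant A) (hk : HasWeight A k) :
    ∃ s : Fin k → ZMod n, Set.range s = residueSet A ∧
      ∀ (f : ZMod n → ℂ) i, ((A * A.transpose).mulVec f) i =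
        ∑ q : Fin k × Fin k, f (i + (s q.1 - s q.2)) := by
  classical
  have hcard : Fintype.card (residueSet A) = k := by
    rw [← Nat.card_eq_fintype_card, Nat.card_coe_set_eq]
    exact hk 0
  let e : Fin k ≃ residueSet A := (Fintype.equivFinOfCardEq hcard).symm
  let s : Fin k → ZMod n := fun a => e a
  have hs : Function.Injective s := Subtype.val_injective.comp e.injective
  have hrange : Set.range s = residueSet A := by
    rw [show s = Subtype.val ∘ e from rfl, Set.range_comp, e.surjective.range_eq, Set.image_univ,
      Subtype.range_coe]
  have hentry (i j : ZMod n) : A i j = ∑ a, if j = i + s a then 1 else 0 := by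
    rw [hA.apply_eq]
    by_cases hj : j - i ∈ residueSet A
    · have h1 : A 0 (j - i) = 1 := hj
      rw [← hrange] at hj
      obtain ⟨b, hb⟩ := hj
      rw [h1, Finset.sum_eq_single b]
      · rw [if_pos (by rw [hb]; ring)]
      · intro a _ hab
        refine if_neg fun h => hab (hs ?_)
        rw [hb, h]; ring
      · simp
    · have h1 : A 0 (j - i) = 0 := (hA.zero_or_one _ _).resolve_right hj
      rw [h1, Finset.sum_eq_zero]
      intro a _
      refine if_neg fun h => hj ?_
      rw [← hrange]
      exact ⟨a, by rw [h]; ring⟩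
  have hmul (f : ZMod n → ℂ) (i) : A.mulVec f i = ∑ a, f (i + s a) := by
    simp only [Matrix.mulVec, dotProduct, hentry, Finset.sum_mul, ite_mul, one_mul, zero_mul]
    rw [Finset.sum_comm]
    simp
  have hmulT (f : ZMod n → ℂ) (i) : A.transpose.mulVec f i = ∑ a, f (i - s a) := by
    simp only [Matrix.mulVec, dotProduct, Matrix.transpose_apply, hentry, Finset.sum_mul, ite_mul,
      one_mul, zero_mul]
    rw [Finset.sum_comm]
    simp [← sub_eq_iff_eq_add]
  refine ⟨s, hrange, fun f i => ?_⟩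
  rw [← Matrix.mulVec_mulVec, hmul, Fintype.sum_prod_type]
  simp only [hmulT, add_sub_assoc]

theorem exists_fourier_ne_zero {n : ℕ} [NeZero n] {g : ZMod n → ℂ} (hg : g ≠ 0) :
    ∃ c : ZMod n, ∑ x, (ZMod.stdAddChar (-(x * c)) : ℂ) * g x ≠ 0 := by
  by_contra! hcon
  apply hg
  have : ZMod.dft g = 0 := by
    ext c
    rw [ZMod.dft_apply]
    simpa using hcon c
  simpa using (LinearEquiv.map_eq_zero_iff _).1 this

/-- An eigenvalue of the first difference operator is an eigenvalue of the second. -/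
theorem exists_sum_stdAddChar_eq {n k : ℕ} [NeZero n] {M N : Matrix (ZMod n) (ZMod n) ℂ}
    (h : AreSimilar M N) {s t : Fin k → ZMod n}
    (hM : ∀ (f : ZMod n → ℂ) i, M.mulVec f i = ∑ q : Fin k × Fin k, f (i + (s q.1 - s q.2)))
    (hN : ∀ (f : ZMod n → ℂ) i, N.mulVec f i = ∑ q : Fin k × Fin k, f (i + (t q.1 - t q.2))) :
    ∃ c : ZMod n, ∑ q : Fin k × Fin k, (ZMod.stdAddChar (s q.1 - s q.2) : ℂ) =
      ∑ q : Fin k × Fin k, (ZMod.stdAddChar (c * (t q.1 - t q.2)) : ℂ) := by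
  obtain ⟨P, hP, hMN⟩ := h
  have hdet := (Matrix.isUnit_iff_isUnit_det P).1 hP
  set μ := ∑ q : Fin k × Fin k, (ZMod.stdAddChar (s q.1 - s q.2) : ℂ) with hμ
  let χ : ZMod n → ℂ := fun x => ZMod.stdAddChar x
  let g := P⁻¹.mulVec χ
  have hχ : P.mulVec g = χ := by
    rw [Matrix.mulVec_mulVec, Matrix.mul_nonsing_inv _ hdet, Matrix.one_mulVec]
  have hg : g ≠ 0 := by
    intro h0
    have h1 := congrFun hχ 0
    rw [h0, Matrix.mulVec_zero] at h1
    simp [χ] at h1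
  have heig : M.mulVec χ = μ • χ := by
    ext i
    rw [hM, Pi.smul_apply, smul_eq_mul, hμ, Finset.sum_mul]
    refine Finset.sum_congr rfl fun q _ => ?_
    rw [mul_comm, ← AddChar.map_add_eq_mul]
  have heigN : N.mulVec g = μ • g := by
    have h1 : P⁻¹ * M = N * P⁻¹ := by
      rw [hMN, mul_assoc P, ← mul_assoc, Matrix.nonsing_inv_mul _ hdet, one_mul]
    rw [Matrix.mulVec_mulVec, ← h1, ← Matrix.mulVec_mulVec, heig, Matrix.mulVec_smul]
  -- `N` multiplies the Fourier coefficient at `c` by its own eigenvalue there, while `g` has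
  -- eigenvalue `μ`; a nonzero coefficient forces the two to agree.
  obtain ⟨c, hc⟩ := exists_fourier_ne_zero hg
  refine ⟨c, mul_right_cancel₀ hc ?_⟩
  calc μ * ∑ x, (ZMod.stdAddChar (-(x * c)) : ℂ) * g x
      = ∑ x, (ZMod.stdAddChar (-(x * c)) : ℂ) * N.mulVec g x := by
        rw [heigN, Finset.mul_sum]
        refine Finset.sum_congr rfl fun x _ => ?_
        simp only [Pi.smul_apply, smul_eq_mul]
        ring
    _ = ∑ q : Fin k × Fin k, ∑ x,
          (ZMod.stdAddChar (-(x * c)) : ℂ) * g (x + (t q.1 - t q.2)) := by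
        simp only [hN, Finset.mul_sum]
        exact Finset.sum_comm
    _ = _ := by
        rw [Finset.sum_mul]
        refine Finset.sum_congr rfl fun q _ => ?_
        rw [Finset.mul_sum, ← Equiv.sum_comp (Equiv.addRight (t q.1 - t q.2)) fun x =>
          (ZMod.stdAddChar (c * (t q.1 - t q.2)) : ℂ) * (ZMod.stdAddChar (-(x * c)) * g x)]
        refine Finset.sum_congr rfl fun x _ => ?_
        rw [← mul_assoc, ← AddChar.map_add_eq_mul]
        simp only [Equiv.coe_addRight]
        congr 2
        ring_nf

theorem exists_perm_of_sum_stdAddChar_eq {n k : ℕ} [NeZero n]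
    (hn : ∀ p : ℕ, p.Prime → p ∣ n → 2 * k * (k - 1) < p) (a b : Fin k × Fin k → ZMod n)
    (ha : ∀ i, a (i, i) = 0) (hb : ∀ i, b (i, i) = 0)
    (h : ∑ q, (ZMod.stdAddChar (a q) : ℂ) = ∑ q, (ZMod.stdAddChar (b q) : ℂ)) :
    ∃ φ : Equiv.Perm (Fin k × Fin k), ∀ q, a q = b (φ q) := by
  let f : ZMod n → ℤ := fun d => ∑ q, ((if a q = d then 1 else 0) - if b q = d then 1 else 0)
  have hsum : ∑ d, |f d| ≤ (2 * k * (k - 1) : ℕ) := by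
    calc ∑ d, |f d| ≤ ∑ d, ∑ q, |(if a q = d then (1 : ℤ) else 0) - if b q = d then 1 else 0| :=
          Finset.sum_le_sum fun d _ => Finset.abs_sum_le_sum_abs _ _
      _ = ∑ q, ∑ d, |(if a q = d then (1 : ℤ) else 0) - if b q = d then 1 else 0| :=
          Finset.sum_comm
      -- Diagonal pairs contribute 0 on both sides and cancel, so the weight is `2k(k-1)` rather
      -- than `2k²`.
      _ ≤ ∑ q : Fin k × Fin k, if q.1 = q.2 then 0 else 2 := by
          refine Finset.sum_le_sum fun q _ => ?_
          split_ifs with hq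
          · obtain ⟨i, j⟩ := q
            obtain rfl : i = j := hq
            simp [ha, hb]
          · calc ∑ d, |(if a q = d then (1 : ℤ) else 0) - if b q = d then 1 else 0|
                ≤ ∑ d, ((if a q = d then (1 : ℤ) else 0) + if b q = d then 1 else 0) :=
                  Finset.sum_le_sum fun d _ => by split_ifs <;> norm_num
              _ = 2 := by rw [Finset.sum_add_distrib]; simp
      _ = (2 * k * (k - 1) : ℕ) := by
          rw [Fintype.sum_prod_type]
          have (i : Fin k) : ∑ j, (if i = j then (0 : ℤ) else 2) = 2 * ((k - 1 : ℕ) : ℤ) := by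
            have hk : 1 ≤ k := by have := i.2; omega
            have h1 : ∀ j, (if i = j then (0 : ℤ) else 2) = 2 - if i = j then 2 else 0 := fun j => by
              split_ifs <;> norm_num
            simp only [h1, Finset.sum_sub_distrib]
            simp [Nat.cast_sub hk]
            ring
          simp only [this]
          simp
          ring
  have hchar : charSum f 1 = 0 := by
    simp only [charSum, f, mul_one]
    push_cast
    simp only [Finset.mul_sum, mul_sub, Finset.sum_sub_distrib]
    rw [Finset.sum_comm, Finset.sum_comm (f := fun d q =>
      (ZMod.stdAddChar d : ℂ) * if b q = d then 1 else 0)]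
    simpa using sub_eq_zero.2 h
  have hf := eq_zero_of_charSum_one_eq_zero f
    (fun p hp hpn => lt_of_le_of_lt hsum (by exact_mod_cast hn p hp hpn)) hchar
  refine exists_perm_of_card_fiber_eq fun d => ?_
  have := congrFun hf d
  simp only [f, Finset.sum_sub_distrib, Pi.zero_apply, sub_eq_zero, Finset.sum_boole] at this
  exact_mod_cast this

/-! ### From a multiplier to a unit, and the conclusion -/

theorem exists_pow_isIdempotentElem {M : Type*} [Monoid M] [Finite M] (c : M) :
    ∃ m : ℕ, c ^ (m + 1) * c ^ (m + 1) = c ^ (m + 1) := by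
  obtain ⟨x, y, hne, hxy⟩ := Finite.exists_ne_map_eq_of_infinite fun m : ℕ => c ^ m
  wlog hlt : x < y generalizing x y
  · exact this y x hne.symm hxy.symm (by omega)
  obtain ⟨r, rfl⟩ := Nat.exists_eq_add_of_lt hlt
  have hstep : ∀ m t : ℕ, c ^ (x + m + t * (r + 1)) = c ^ (x + m) := by
    intro m t
    induction t with
    | zero => simp
    | succ t ih =>
      rw [← ih, show x + m + (t + 1) * (r + 1) = (x + r + 1) + (m + t * (r + 1)) by ring, pow_add,
        ← hxy, ← pow_add]
      congr 1
      ring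
  -- The exponent becomes `(x + 1)(r + 1)`: a multiple of the period `r + 1`, beyond the preperiod
  -- `x`.
  refine ⟨x + (x * r + r), ?_⟩
  have := hstep (x * r + r + 1) (x + 1)
  rw [← pow_add]
  convert this using 2 <;> ring

/-- If multiplication by `i` and `j` carry two families onto each other, then `j` may be replaced by
a unit. -/
theorem exists_isUnit_mul_eq {R κ : Type*} [CommRing R] [Finite R] (a b : κ → R) (i j : R)
    (hab : ∀ q, ∃ r, a q = j * b r) (hba : ∀ q, ∃ r, b q = i * a r) :
    ∃ u : R, IsUnit u ∧ ∀ q, j * b q = u * b q := by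
  obtain ⟨m, hm⟩ := exists_pow_isIdempotentElem (i * j)
  set e := (i * j) ^ (m + 1) with he
  have hpow : ∀ N q, ∃ r, b q = (i * j) ^ N * b r := by
    intro N
    induction N with
    | zero => exact fun q => ⟨q, by simp⟩
    | succ N ih =>
      intro q
      obtain ⟨r, hr⟩ := ih q
      obtain ⟨r₁, hr₁⟩ := hba r
      obtain ⟨r₂, hr₂⟩ := hab r₁
      exact ⟨r₂, by rw [hr, hr₁, hr₂]; ring⟩
  have hfix : ∀ q, e * b q = b q := fun q => by
    obtain ⟨r, hr⟩ := hpow (m + 1) q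
    rw [hr, ← mul_assoc, ← he, hm]
  have hee : j * i * (i * j) ^ m = e := by rw [he, pow_succ]; ring
  -- Every `b q` is fixed by the idempotent `e`, a power of `i * j`. On the factor `eR` the element
  -- `j` is invertible; on the complementary factor it is replaced by 1.
  refine ⟨j * e + (1 - e), IsUnit.of_mul_eq_one (i * (i * j) ^ m * e + (1 - e)) ?_, fun q => ?_⟩
  · linear_combination (e * e) * hee + (e + 2 - i * (i * j) ^ m - j) * hm
  · linear_combination (1 - j) * hfix q

theorem affinelyEquivalent_of_areSimilar {k n : ℕ} [NeZero n] (hk : k = 4 ∨ k = 5)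
    (hn : ∀ p : ℕ, p.Prime → p ∣ n → 2 * k * (k - 1) < p)
    {A B : Matrix (ZMod n) (ZMod n) ℂ}
    (hA : IsZeroOneCirculant A) (hB : IsZeroOneCirculant B)
    (hAk : HasWeight A k) (hBk : HasWeight B k)
    (h : AreSimilar (A * A.transpose) (B * B.transpose)) :
    AffinelyEquivalent (residueSet A) (residueSet B) := by
  obtain ⟨s, hs, hsA⟩ := exists_points hA hAk
  obtain ⟨t, ht, htB⟩ := exists_points hB hBk
  have h' : AreSimilar (B * B.transpose) (A * A.transpose) := by
    obtain ⟨P, hP, hPe⟩ := h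
    have hdet := (Matrix.isUnit_iff_isUnit_det P).1 hP
    refine ⟨P⁻¹, (Matrix.isUnit_nonsing_inv_iff).2 hP, ?_⟩
    rw [hPe, Matrix.nonsing_inv_nonsing_inv _ hdet, mul_assoc P, ← mul_assoc P⁻¹,
      Matrix.nonsing_inv_mul _ hdet, one_mul, mul_assoc, Matrix.nonsing_inv_mul _ hdet, mul_one]
  obtain ⟨j, hj⟩ := exists_sum_stdAddChar_eq h hsA htB
  -- The eigenvalue match alone does not make `j` a unit; the reverse multiplier `i` is what allows
  -- `j` to be replaced by one.
  obtain ⟨i, hi⟩ := exists_sum_stdAddChar_eq h' htB hsA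
  obtain ⟨φ, hφ⟩ := exists_perm_of_sum_stdAddChar_eq hn (fun q => s q.1 - s q.2)
    (fun q => j * (t q.1 - t q.2)) (by simp) (by simp) hj
  obtain ⟨ψ, hψ⟩ := exists_perm_of_sum_stdAddChar_eq hn (fun q => t q.1 - t q.2)
    (fun q => i * (s q.1 - s q.2)) (by simp) (by simp) hi
  obtain ⟨u, hu, hju⟩ := exists_isUnit_mul_eq (fun q : Fin k × Fin k => s q.1 - s q.2)
    (fun q : Fin k × Fin k => t q.1 - t q.2) i j (fun q => ⟨φ q, hφ q⟩) (fun q => ⟨ψ q, hψ q⟩)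
  obtain ⟨ε, σ, v, hε, hσ⟩ := homometric_zmod hk hn φ s (fun a => u * t a) (fun q => by
    have h1 := hφ q
    have h2 := hju (φ q)
    rw [h1, h2, mul_sub])
  refine ⟨ε * u, v, ?_, ?_⟩
  · rcases hε with rfl | rfl <;> simpa using hu
  · rw [← hs, ← ht, ← Set.range_comp]
    rw [← σ.surjective.range_comp ((fun t => (ε * u) * t + v) ∘ t)]
    congr 1
    ext a
    simp only [Function.comp, hσ, mul_assoc]

theorem mainTheorem3 (k n : ℕ) [NeZero n] (hk : k = 4 ∨ k = 5)
    (hn : ∀ p : ℕ, p.Prime → p ∣ n → 2 * k * (k - 1) < p)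
    (A B : Matrix (ZMod n) (ZMod n) ℂ)
    (hA : IsZeroOneCirculant A) (hB : IsZeroOneCirculant B)
    (hAk : HasWeight A k) (hBk : HasWeight B k) :
    List.TFAE [
      AffinelyEquivalent (residueSet A) (residueSet B),
      ∃ P Q : Matrix (ZMod n) (ZMod n) ℂ,
        IsPermutationMatrix P ∧ IsPermutationMatrix Q ∧ A = P * B * Q,
      ∃ P : Matrix (ZMod n) (ZMod n) ℂ,
        IsPermutationMatrix P ∧ A * A.transpose = P * (B * B.transpose) * P⁻¹,
      AreSimilar (A * A.transpose) (B * B.transpose)] := by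
  tfae_have 1 → 2 := exists_permutation_of_affinelyEquivalent hA hB
  tfae_have 2 → 3 := by
    rintro ⟨P, Q, hP, hQ, rfl⟩
    refine ⟨P, hP, ?_⟩
    rw [Matrix.inv_eq_right_inv hP.mul_transpose, Matrix.transpose_mul, Matrix.transpose_mul]
    simp only [mul_assoc]
    rw [← mul_assoc Q, hQ.mul_transpose, one_mul]
  tfae_have 3 → 4 := by
    rintro ⟨P, hP, h⟩
    exact ⟨P, (Matrix.isUnit_iff_isUnit_det P).2
      (Matrix.isUnit_det_of_right_inverse hP.mul_transpose), h⟩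
  tfae_have 4 → 1 := affinelyEquivalent_of_areSimilar hk hn hA hB hAk hBk
  tfae_finish
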